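/- All rings are commutative. Let $(R,\mathfrak m,k)$ be a Noetherian local ring. For a linear map $g:F\to F'$ of free modules of finite rank, $I^r(g)$ is the ideal generated by the $r\times r$ minors of $g$; it is $0$ if $r$ exceeds the rank of $F$ or $F'$, except that $I^r(g)=R$ whenever $F=0$ or $F'=0$. Let $M$ be a bounded below complex (homological indexing) of finitely generated $R$-modules with minimal free resolution $F\xrightarrow{\simeq}M$, and let $F_{\ge n}$ be the complex $\cdots\to F_{n+1}\to F_n\to 0$. For a bounded below complex $G$ of finitely generated free modules with $G\neq 0$ put $I^{\mathrm{tot}}(G,r)=\sum_{m>\inf(G)} I^r(G_m\to G_{m-1})$, where $\inf(G)=\min\{i: G_i\ne0\}$, and put $I^{\mathrm{tot}}(0,r)=R$. Define $$I^{\mathrm{tot}}(M,r)=I^{\mathrm{tot}}(F,r),\qquad I^{\mathrm{stab}}(M,r)=\bigcap_{n\ge \inf(F)} I^{\mathrm{tot}}(F_{\ge n},r)$$ (with $I^{\mathrm{stab}}(M,r)=R$ if $F=0$). A module is regarded as a complex concentrated in degree $0$. Let $C^{+,f}(\mathrm{mod}\text{-}R)$ be the class of bounded below complexes of finitely generated $R$-modules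 with bounded homology, let $\mathrm{mod}(R)$ be the class of finitely generated $R$-modules, and for either class $\mathcal C$ put $I^{\mathrm{stab}}(\mathcal C,r)=\bigcap_{M\in\mathcal C} I^{\mathrm{tot}}(M,r)$. Let $$\mathrm{ca}(R)=\bigcup_{n\ge0}\ \bigcap_{i\ge n}\ \bigcap_{M,N\in\mathrm{mod}(R)}\mathrm{ann}_R\,\mathrm{Ext}^i_R(M,N)$$ be the cohomology annihilator of $R$. 1. For every $M\in C^{+,f}(\mathrm{mod}\text{-}R)$ we have $\mathrm{ca}(R)\subseteq I^{\mathrm{stab}}(M,1)$. Moreover $\mathrm{ca}(R)\subseteq I^{\mathrm{stab}}(C^{+,f}(\mathrm{mod}\text{-}R),1)=I^{\mathrm{stab}}(\mathrm{mod}(R),1)$. In particular, if $\mathrm{ca}(R)\ne0$, then $I^{\mathrm{stab}}(C^{+,f}(\mathrm{mod}\text{-}R),1)\neq0$. 2. If $R$ is not regular, then $I^{\mathrm{stab}}(k,1)=\mathfrak m$. Moreover, for every $R$-module $L$ of finite length, $I^{\mathrm{stab}}(L,1)$ is $\mathfrak m$-primary if $L$ has infinite projective dimension, and $I^{\mathrm{stab}}(L,1)=R$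 if $L$ has finite projective dimension. -/

import Mathlib

open CategoryTheory CategoryTheory.Limits IsLocalRing

universe u

namespace StableMinors

/-- The ideal `I^r(g)` generated by the `r × r` minors of a linear map `g` between free modules of
finite rank. The span of the minors is the same for every choice of bases, so all bases are
allowed at once. By convention `I^r(g) = R` when the source or the target of `g` is zero. -/
noncomputable def minorsIdeal {R : Type u} [CommRing R] {M N : Type u} [AddCommGroup M]
    [Module R M] [AddCommGroup N] [Module R N] (r : ℕ) (g : M →ₗ[R] N) : Ideal R :=
  open Classical in
  if Subsingleton M ∨ Subsingleton N then ⊤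
  else Ideal.span {x | ∃ (p q : ℕ) (b : Module.Basis (Fin p) R M) (c : Module.Basis (Fin q) R N)
    (rows : Fin r ↪ Fin q) (cols : Fin r ↪ Fin p),
    x = ((LinearMap.toMatrix b c g).submatrix rows cols).det}

/-- The inclusion of the degrees `≥ n`, for complexes with homological indexing. -/
def embeddingGE (n : ℤ) : (ComplexShape.down ℕ).Embedding (ComplexShape.down ℤ) :=
  ComplexShape.Embedding.mk' _ _ (fun i => n + i)
    (fun _ _ h => by simpa using h)
    (fun i j => by simp only [ComplexShape.down_Rel]; omega)

instance (n : ℤ) : (embeddingGE n).IsRelIff where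
  rel' i j h := by
    change n + (j : ℤ) + 1 = n + (i : ℤ) at h
    simp only [ComplexShape.down_Rel]
    omega

section Complexes

variable {R : Type u} [CommRing R]

/-- The truncation `F_{≥ n}` of a complex of free modules: the modules `F_i` with `i ≥ n` and the
differentials between them, and zero in degrees `< n`. If `n` is at least every degree in which
`F` has homology and `F` is a minimal complex of free modules, this is (up to a shift) the minimal
free resolution of the cokernel of `F_{n+1} → F_n`. -/
noncomputable def truncGE (F : ChainComplex (ModuleCat.{u} R) ℤ) (n : ℤ) :
    ChainComplex (ModuleCat.{u} R) ℤ :=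
  F.stupidTrunc (embeddingGE n)

/-- The total ideal `∑_m I^r_m(F)` of a bounded below complex `F` of free modules, where
`I^r_m(F) = I^r(F_m → F_{m-1})` and `m` ranges over the degrees above `inf F`, i.e. those for
which `F_m → F_{m-1}` is not the differential out of (or below) the bottom nonzero module of `F`.
If `F = 0`, then `m` ranges over all integers, and the ideal is `R`. -/
noncomputable def totalIdeal (F : ChainComplex (ModuleCat.{u} R) ℤ) (r : ℕ) : Ideal R :=
  ⨆ (m : ℤ) (_ : (∃ i < m, ¬ IsZero (F.X i)) ∨ ∀ i, IsZero (F.X i)),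
    minorsIdeal r (F.d m (m - 1)).hom

/-- The stable ideal `⋂_{n ≥ inf F} ∑_m I^r_m(F_{≥ n})` of a bounded below complex `F` of free
modules. -/
noncomputable def stableIdeal (F : ChainComplex (ModuleCat.{u} R) ℤ) (r : ℕ) : Ideal R :=
  ⨅ (n : ℤ) (_ : ∃ i ≤ n, ¬ IsZero (F.X i)), totalIdeal (truncGE F n) r

/-- `f : F ⟶ M` is a minimal free resolution of the complex `M`. -/
structure IsMinimalFreeResolution [IsLocalRing R] {F M : ChainComplex (ModuleCat.{u} R) ℤ}
    (f : F ⟶ M) : Prop where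
  free : ∀ i, Module.Free R (F.X i)
  finite : ∀ i, Module.Finite R (F.X i)
  boundedBelow : ∃ a : ℤ, ∀ i < a, IsZero (F.X i)
  minimal : ∀ i j, LinearMap.range (F.d i j).hom ≤ maximalIdeal R • (⊤ : Submodule R (F.X j))
  quasiIso : QuasiIso f

/-- `I^tot(M, r)`: the total ideal of the minimal free resolution of `M`. The resolution is unique
up to isomorphism, so the infimum is over equal ideals. -/
noncomputable def Itot [IsLocalRing R] (M : ChainComplex (ModuleCat.{u} R) ℤ) (r : ℕ) : Ideal R :=
  ⨅ (F : ChainComplex (ModuleCat.{u} R) ℤ) (f : F ⟶ M) (_ : IsMinimalFreeResolution f),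
    totalIdeal F r

/-- `I^stab(M, r)`: the stable ideal of the minimal free resolution of `M`. The resolution is
unique up to isomorphism, so the infimum is over equal ideals. -/
noncomputable def Istab [IsLocalRing R] (M : ChainComplex (ModuleCat.{u} R) ℤ) (r : ℕ) : Ideal R :=
  ⨅ (F : ChainComplex (ModuleCat.{u} R) ℤ) (f : F ⟶ M) (_ : IsMinimalFreeResolution f),
    stableIdeal F r

/-- Bounded below complexes of finitely generated modules with bounded homology: the objects of
`C^{+,f}(mod-R)`. -/
structure IsCPlusF (M : ChainComplex (ModuleCat.{u} R) ℤ) : Prop where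
  finite : ∀ i, Module.Finite R (M.X i)
  boundedBelow : ∃ a : ℤ, ∀ i < a, IsZero (M.X i)
  boundedHomology : ∃ b : ℤ, ∀ i > b, IsZero (M.homology i)

/-- A module, as a complex concentrated in degree zero. -/
noncomputable def moduleComplex (L : ModuleCat.{u} R) : ChainComplex (ModuleCat.{u} R) ℤ :=
  (HomologicalComplex.single (ModuleCat.{u} R) (ComplexShape.down ℤ) 0).obj L

variable (R) in
/-- `I^stab(C^{+,f}(mod-R), r)`: the intersection of the total ideals `I^tot(M, r)` over all `M`
in `C^{+,f}(mod-R)`. -/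
noncomputable def IstabCPlusF [IsLocalRing R] (r : ℕ) : Ideal R :=
  ⨅ (M : ChainComplex (ModuleCat.{u} R) ℤ) (_ : IsCPlusF M), Itot M r

variable (R) in
/-- `I^stab(mod(R), r)`: the intersection of the total ideals `I^tot(L, r)` over all finitely
generated modules `L`. -/
noncomputable def IstabMod [IsLocalRing R] (r : ℕ) : Ideal R :=
  ⨅ (L : ModuleCat.{u} R) (_ : Module.Finite R L), Itot (moduleComplex L) r

variable (R) in
/-- `ca^n(R)`: the elements that annihilate `Ext^i_R(M, N)` for all `i ≥ n` and all finitely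
generated modules `M` and `N`. -/
noncomputable def caN (n : ℕ) : Ideal R :=
  ⨅ (M : ModuleCat.{u} R) (N : ModuleCat.{u} R) (_ : Module.Finite R M) (_ : Module.Finite R N)
    (i : ℕ) (_ : n ≤ i), Module.annihilator R (Abelian.Ext M N i)

variable (R) in
lemma caN_mono : Monotone (caN R) := by
  intro a b h
  unfold caN
  exact iInf_mono fun M => iInf_mono fun N => iInf_mono fun _ => iInf_mono fun _ =>
    iInf_mono fun i => le_iInf fun hi => iInf_le_of_le (h.trans hi) le_rfl

variable (R) in
/-- The cohomology annihilator `ca(R)`, the union of the increasing chain of the `ca^n(R)`. -/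
noncomputable def ca : Ideal R := ⨆ n, caN R n

lemma mem_ca {x : R} : x ∈ ca R ↔ ∃ n, x ∈ caN R n :=
  Submodule.mem_iSup_of_directed _ (caN_mono R).directed_le

end Complexes

/-- The ideal `I` is primary to the maximal ideal. -/
def IsMaximalPrimary {R : Type u} [CommRing R] [IsLocalRing R] (I : Ideal R) : Prop :=
  I.IsPrimary ∧ I.radical = maximalIdeal R

end StableMinors

/-! Suppose `a` kills `Ext^i(X, -)` on finitely generated modules for all large `i`. Dimension
shifting along a free resolution `K` of `X` makes `a` kill `Ext^1` of high syzygies, so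
multiplication by `a` on a syzygy extends to the free module containing it. Lifting twice gives `a =
d s' + s d` on a high term of `K`, and one diagonal matrix entry puts `a` in the sum of two
consecutive ideals of entries (`IsResolution.mem_minorsIdeal_sup`). This happens in arbitrarily high
degrees, so `a` lies in the total ideal of every truncation.

For part 1, a minimal resolution of a complex with bounded homology, truncated above that homology,
minimally resolves a finitely generated module; this lets `ca(R)` act and reduces complexes to
modules. For part 2, take `a` in the annihilator of `L`, or `a = 1` when the projective dimension is
finite. If it is infinite, no term of a minimal resolution vanishes, so all entries lie in `𝔪`.

Nonregularity enters through Serre's theorem that finite projective dimension of `k` forces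
regularity, proved by induction on dimension, cutting by a regular `x ∈ 𝔪 ∖ 𝔪²`.

Lower bounds hold for each minimal resolution separately and upper bounds need only one, so
uniqueness of resolutions is never used. -/

namespace StableMinors

/-! ### Ideals of minors and null-homotopies. -/

section Minors

variable {R : Type u} [CommRing R] {M N M' N' : Type u} [AddCommGroup M] [Module R M]
  [AddCommGroup N] [Module R N] [AddCommGroup M'] [Module R M'] [AddCommGroup N'] [Module R N']

lemma minorsIdeal_eq_top (r : ℕ) (g : M →ₗ[R] N) (h : Subsingleton M ∨ Subsingleton N) :
    minorsIdeal r g = ⊤ := if_pos h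

lemma minorsIdeal_le_of_equiv (r : ℕ) {g : M →ₗ[R] N} {g' : M' →ₗ[R] N'} (e₁ : M ≃ₗ[R] M')
    (e₂ : N ≃ₗ[R] N') (h : ∀ x, g' (e₁ x) = e₂ (g x)) : minorsIdeal r g ≤ minorsIdeal r g' := by
  by_cases hs : Subsingleton M' ∨ Subsingleton N'
  · rw [minorsIdeal_eq_top r g' hs]
    exact le_top
  have hs' : ¬ (Subsingleton M ∨ Subsingleton N) := by
    rwa [e₁.toEquiv.subsingleton_congr, e₂.toEquiv.subsingleton_congr]
  rw [minorsIdeal, minorsIdeal, if_neg hs, if_neg hs']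
  refine Ideal.span_mono ?_
  rintro x ⟨p, q, b, c, rows, cols, rfl⟩
  refine ⟨p, q, b.map e₁, c.map e₂, rows, cols, ?_⟩
  congr 2
  ext i j
  simp [LinearMap.toMatrix_apply, h]

lemma minorsIdeal_congr (r : ℕ) {g : M →ₗ[R] N} {g' : M' →ₗ[R] N'} (e₁ : M ≃ₗ[R] M')
    (e₂ : N ≃ₗ[R] N') (h : ∀ x, g' (e₁ x) = e₂ (g x)) : minorsIdeal r g = minorsIdeal r g' :=
  le_antisymm (minorsIdeal_le_of_equiv r e₁ e₂ h)
    (minorsIdeal_le_of_equiv r e₁.symm e₂.symm fun x ↦ by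
      apply e₂.injective
      rw [← h]
      simp)

lemma apply_mem_minorsIdeal_one [Module.Free R M] [Module.Finite R M] [Module.Free R N]
    [Module.Finite R N] (g : M →ₗ[R] N) (l : N →ₗ[R] R) (x : M) : l (g x) ∈ minorsIdeal 1 g := by
  by_cases hs : Subsingleton M ∨ Subsingleton N
  · simp [minorsIdeal_eq_top 1 g hs]
  obtain ⟨h₁, -⟩ := not_or.mp hs
  rw [not_subsingleton_iff_nontrivial] at h₁
  have : Nontrivial R := Module.nontrivial R M
  let b := Module.finBasis R M
  let c := Module.finBasis R N
  have key : ∀ i j, c.repr (g (b j)) i ∈ minorsIdeal 1 g := by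
    intro i j
    rw [minorsIdeal, if_neg hs]
    refine Ideal.subset_span ⟨_, _, b, c, ⟨fun _ ↦ i, fun _ _ _ ↦ Subsingleton.elim _ _⟩,
      ⟨fun _ ↦ j, fun _ _ _ ↦ Subsingleton.elim _ _⟩, ?_⟩
    simp [LinearMap.toMatrix_apply]
    rfl
  rw [← b.sum_repr x, map_sum, map_sum]
  refine Ideal.sum_mem _ fun j _ ↦ ?_
  rw [map_smul, map_smul]
  refine Ideal.mul_mem_left _ _ ?_
  rw [← c.sum_repr (g (b j)), map_sum]
  refine Ideal.sum_mem _ fun i _ ↦ ?_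
  rw [map_smul]
  exact Ideal.mul_mem_right _ _ (key i j)

/-- Every functional sends `I • N` into `I`, in particular the coordinates. The modules must be
nonzero, since otherwise the convention makes the ideal `R`. -/
lemma minorsIdeal_one_le {I : Ideal R} (g : M →ₗ[R] N) (hM : ¬ Subsingleton M)
    (hN : ¬ Subsingleton N) (h : LinearMap.range g ≤ I • (⊤ : Submodule R N)) :
    minorsIdeal 1 g ≤ I := by
  rw [minorsIdeal, if_neg (not_or.mpr ⟨hM, hN⟩), Ideal.span_le]
  rintro x ⟨p, q, b, c, rows, cols, rfl⟩
  have key (l : N →ₗ[R] R) (y : N) (hy : y ∈ I • (⊤ : Submodule R N)) : l y ∈ I := by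
    induction hy using Submodule.smul_induction_on' with
    | smul r hr n _ =>
      rw [map_smul]
      exact Ideal.mul_mem_right _ _ hr
    | add x _ y _ hx hy =>
      rw [map_add]
      exact add_mem hx hy
  rw [SetLike.mem_coe, Matrix.det_unique, Matrix.submatrix_apply, LinearMap.toMatrix_apply]
  exact key (c.coord _) _ (h ⟨_, rfl⟩)

/-- A diagonal entry of `d h + h' d' = a` is a functional applied to a value of `d` plus a
functional applied to a value of `d'`. -/
lemma mem_minorsIdeal_sup_of_homotopy [Module.Free R M] [Module.Finite R M] [Module.Free R N]
    [Module.Finite R N] [Module.Free R M'] [Module.Finite R M'] (d : M →ₗ[R] N) (d' : N →ₗ[R] M')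
    (h : N →ₗ[R] M) (h' : M' →ₗ[R] N) (a : R) (hd : ∀ x, d (h x) + h' (d' x) = a • x) :
    a ∈ minorsIdeal 1 d ⊔ minorsIdeal 1 d' := by
  by_cases hs : Subsingleton N
  · simp [minorsIdeal_eq_top 1 d (Or.inr hs)]
  rw [not_subsingleton_iff_nontrivial] at hs
  have : Nontrivial R := Module.nontrivial R N
  let b := Module.finBasis R N
  obtain ⟨i⟩ := b.index_nonempty
  have : a = b.coord i (d (h (b i))) + (b.coord i ∘ₗ h') (d' (b i)) := by
    rw [LinearMap.comp_apply, ← map_add, hd]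
    simp
  rw [this]
  exact Submodule.add_mem_sup (apply_mem_minorsIdeal_one d _ _) (apply_mem_minorsIdeal_one d' _ _)

end Minors

/-! ### Truncations and total ideals. -/

section Truncation

variable {R : Type u} [CommRing R]

/-- The total ideal of a complex of free modules indexed by the natural numbers. -/
noncomputable def natTotalIdeal (K : ChainComplex (ModuleCat.{u} R) ℕ) (r : ℕ) : Ideal R :=
  ⨆ (m : ℕ) (_ : (∃ i ≤ m, ¬ IsZero (K.X i)) ∨ ∀ i, IsZero (K.X i)),
    minorsIdeal r (K.d (m + 1) m).hom

lemma natTotalIdeal_eq_top (K : ChainComplex (ModuleCat.{u} R) ℕ) (r : ℕ)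
    (h : ∀ i, IsZero (K.X i)) : natTotalIdeal K r = ⊤ := by
  rw [eq_top_iff]
  refine le_iSup₂_of_le 0 (Or.inr h) ?_
  rw [minorsIdeal_eq_top]
  exact Or.inl (ModuleCat.subsingleton_of_isZero (h _))

lemma embeddingGE_f (n : ℤ) (i : ℕ) : (embeddingGE n).f i = n + i := rfl

lemma isZero_extend_embeddingGE (K : ChainComplex (ModuleCat.{u} R) ℕ) (n i : ℤ) (h : i < n) :
    IsZero ((K.extend (embeddingGE n)).X i) :=
  K.isZero_extend_X _ _ fun j ↦ by rw [embeddingGE_f]; omega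

lemma isZero_extend_embeddingGE_iff (K : ChainComplex (ModuleCat.{u} R) ℕ) (n i : ℤ) (j : ℕ)
    (h : n + j = i) : IsZero ((K.extend (embeddingGE n)).X i) ↔ IsZero (K.X j) :=
  (K.extendXIso (embeddingGE n) (i := j) h).isZero_iff

/-- The degrees enter through equations, so that integer identities need not be rewritten inside the
type of a differential. -/
lemma minorsIdeal_extend (K : ChainComplex (ModuleCat.{u} R) ℕ) (n : ℤ) (r m : ℕ) (p q : ℤ)
    (hp : n + (m + 1) = p) (hq : n + m = q) :
    minorsIdeal r ((K.extend (embeddingGE n)).d p q).hom = minorsIdeal r (K.d (m + 1) m).hom := by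
  have hp' : (embeddingGE n).f (m + 1) = p := by rw [embeddingGE_f]; push_cast; exact hp
  have hq' : (embeddingGE n).f m = q := hq
  refine minorsIdeal_congr r (K.extendXIso _ hp').toLinearEquiv (K.extendXIso _ hq').toLinearEquiv
    fun x ↦ ?_
  rw [K.extend_d_eq _ hp' hq']
  simp

lemma totalIdeal_extend (K : ChainComplex (ModuleCat.{u} R) ℕ) (n : ℤ) (r : ℕ) :
    totalIdeal (K.extend (embeddingGE n)) r = natTotalIdeal K r := by
  apply le_antisymm
  · refine iSup₂_le fun m hm ↦ ?_
    obtain ⟨i, him, hi⟩ | h0 := hm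
    · have hin : n ≤ i := by
        by_contra! h
        exact hi (isZero_extend_embeddingGE K n i h)
      obtain ⟨j, rfl⟩ := Int.le.dest hin
      obtain ⟨t, rfl⟩ := Int.le.dest him
      rw [minorsIdeal_extend K n r (j + t) _ _ (by push_cast; ring) (by push_cast; ring)]
      refine le_iSup₂_of_le (j + t) (Or.inl ⟨j, by omega, ?_⟩) le_rfl
      rwa [← isZero_extend_embeddingGE_iff K n _ j rfl]
    · have h0' : ∀ i, IsZero (K.X i) := fun i ↦ by
        rw [← isZero_extend_embeddingGE_iff K n _ i rfl]
        exact h0 _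
      rw [natTotalIdeal_eq_top K r h0']
      exact le_top
  · refine iSup₂_le fun m hm ↦ ?_
    -- Index `m` on the `ℕ` side has source degree `n + m + 1`, which turns `i ≤ m` into a strict
    -- inequality.
    rw [← minorsIdeal_extend K n r m (n + m + 1) (n + m + 1 - 1) (by ring) (by ring)]
    refine le_iSup₂_of_le (f := fun (m : ℤ) _ ↦
      minorsIdeal r ((K.extend (embeddingGE n)).d m (m - 1)).hom) (n + m + 1) ?_ le_rfl
    obtain ⟨i, him, hi⟩ | h0 := hm
    · refine Or.inl ⟨n + i, by omega, ?_⟩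
      rwa [isZero_extend_embeddingGE_iff K n _ i rfl]
    · refine Or.inr fun i ↦ ?_
      by_cases hin : i < n
      · exact isZero_extend_embeddingGE K n i hin
      · obtain ⟨j, rfl⟩ := Int.le.dest (not_lt.mp hin)
        rw [isZero_extend_embeddingGE_iff K n _ j rfl]
        exact h0 j

/-- The part of a complex in degrees `≥ n`, shifted to start in degree zero. -/
noncomputable abbrev restrictGE (F : ChainComplex (ModuleCat.{u} R) ℤ) (n : ℤ) :
    ChainComplex (ModuleCat.{u} R) ℕ :=
  F.restriction (embeddingGE n)

lemma totalIdeal_truncGE (F : ChainComplex (ModuleCat.{u} R) ℤ) (n : ℤ) (r : ℕ) :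
    totalIdeal (truncGE F n) r = natTotalIdeal (restrictGE F n) r :=
  totalIdeal_extend _ _ _

lemma minorsIdeal_le_totalIdeal_truncGE (F : ChainComplex (ModuleCat.{u} R) ℤ) (n : ℤ) (r : ℕ)
    (i m : ℤ) (hn : n ≤ i) (him : i < m) (hi : ¬ IsZero (F.X i)) :
    minorsIdeal r (F.d m (m - 1)).hom ≤ totalIdeal (truncGE F n) r := by
  rw [totalIdeal_truncGE]
  obtain ⟨j, rfl⟩ := Int.le.dest hn
  obtain ⟨t, rfl⟩ := Int.le.dest him
  refine le_iSup₂_of_le (j + t) (Or.inl ⟨j, by omega, hi⟩) ?_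
  have h₁ : n + j + 1 + t = n + (j + t + 1 : ℕ) := by push_cast; ring
  have h₂ : n + j + 1 + t - 1 = n + (j + t : ℕ) := by push_cast; ring
  rw [h₂, h₁]
  rfl

lemma totalIdeal_truncGE_eq_top (F : ChainComplex (ModuleCat.{u} R) ℤ) (n : ℤ) (r : ℕ)
    (h : ∀ i ≥ n, IsZero (F.X i)) : totalIdeal (truncGE F n) r = ⊤ := by
  rw [totalIdeal_truncGE]
  exact natTotalIdeal_eq_top _ _ fun i ↦ h _ (by rw [embeddingGE_f]; omega)

/-- Truncating drops summands. The delicate case is a zero truncation, with ideal `R`: there `F`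
itself contributes a differential with zero source, so its ideal is `R` too. -/
lemma totalIdeal_truncGE_le (F : ChainComplex (ModuleCat.{u} R) ℤ) (n : ℤ) (r : ℕ) :
    totalIdeal (truncGE F n) r ≤ totalIdeal F r := by
  by_cases h : ∀ i ≥ n, IsZero (F.X i)
  · by_cases h' : ∀ i, IsZero (F.X i)
    · refine le_iSup₂_of_le 0 (Or.inr h') ?_
      rw [minorsIdeal_eq_top]
      · exact le_top
      · exact Or.inl (ModuleCat.subsingleton_of_isZero (h' _))
    · push Not at h'
      obtain ⟨j, hj⟩ := h'
      refine le_iSup₂_of_le (max n (j + 1)) (Or.inl ⟨j, by omega, hj⟩) ?_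
      rw [minorsIdeal_eq_top]
      · exact le_top
      · exact Or.inl (ModuleCat.subsingleton_of_isZero (h _ (le_max_left _ _)))
  · rw [totalIdeal_truncGE]
    refine iSup₂_le fun m hm ↦ ?_
    obtain ⟨i, him, hi⟩ | h0 := hm
    · refine le_iSup₂_of_le (n + m + 1) (Or.inl ⟨n + i, by omega, hi⟩) ?_
      have h₁ : n + m + 1 = n + (m + 1 : ℕ) := by push_cast; ring
      have h₂ : n + m + 1 - 1 = n + m := by ring
      rw [h₂, h₁]
      exact le_rfl
    · refine absurd (fun i hi ↦ ?_) h
      obtain ⟨j, rfl⟩ := Int.le.dest hi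
      exact h0 j

/-- An element lies in the total ideals of all truncations as soon as it lies in the sum of two
consecutive ideals of entries in arbitrarily large degrees. -/
lemma mem_totalIdeal_truncGE (F : ChainComplex (ModuleCat.{u} R) ℤ) (a : R) (r : ℕ)
    (h : ∀ b : ℤ, ∃ m ≥ b,
      a ∈ minorsIdeal r (F.d (m + 1) m).hom ⊔ minorsIdeal r (F.d m (m - 1)).hom)
    (n : ℤ) : a ∈ totalIdeal (truncGE F n) r := by
  by_cases h0 : ∀ i ≥ n, IsZero (F.X i)
  · simp [totalIdeal_truncGE_eq_top F n r h0]
  · push Not at h0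
    obtain ⟨i, hin, hi⟩ := h0
    -- The bound `i + 1` keeps both sources, `m + 1` and `m`, strictly above the nonzero term `F_i`.
    obtain ⟨m, hm, ha⟩ := h (i + 1)
    refine (sup_le ?_ ?_ : _ ≤ totalIdeal (truncGE F n) r) ha
    · have := minorsIdeal_le_totalIdeal_truncGE F n r i (m + 1) hin (by omega) hi
      rwa [add_sub_cancel_right] at this
    · exact minorsIdeal_le_totalIdeal_truncGE F n r i m hin (by omega) hi

end Truncation

/-! ### Free resolutions and annihilation of Ext. -/

section Resolutions

variable {R : Type u} [CommRing R]

/-- `K` is a resolution of `X` with augmentation `p`. -/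
structure IsResolution (K : ChainComplex (ModuleCat.{u} R) ℕ) {X : ModuleCat.{u} R}
    (p : K.X 0 ⟶ X) : Prop where
  surjective : Function.Surjective p.hom
  exact_zero : Function.Exact (K.d 1 0).hom p.hom
  exact_succ : ∀ i, Function.Exact (K.d (i + 2) (i + 1)).hom (K.d (i + 1) i).hom

/-- The image of the differential into degree `i`. -/
abbrev boundaries (K : ChainComplex (ModuleCat.{u} R) ℕ) (i : ℕ) : Submodule R (K.X i) :=
  LinearMap.range (K.d (i + 1) i).hom

lemma subtype_comp_eq_zero {P X : ModuleCat.{u} R} (S : Submodule R P) (p : P ⟶ X)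
    (h : LinearMap.ker p.hom = S) : ModuleCat.ofHom S.subtype ≫ p = 0 := by
  ext x
  have : (x : P) ∈ LinearMap.ker p.hom := h ▸ x.2
  simpa using this

lemma shortExact_subtype {P X : ModuleCat.{u} R} (S : Submodule R P) (p : P ⟶ X)
    (h : LinearMap.ker p.hom = S) (hp : Function.Surjective p.hom) :
    (ShortComplex.mk (ModuleCat.ofHom S.subtype) p (subtype_comp_eq_zero S p h)).ShortExact := by
  apply ModuleCat.shortComplex_shortExact
  · intro x
    simp [← LinearMap.mem_ker, h]
  · exact S.injective_subtype
  · exact hp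

/-- The differential as a map onto its image. -/
noncomputable abbrev toBoundaries (K : ChainComplex (ModuleCat.{u} R) ℕ) (i : ℕ) :
    K.X (i + 1) ⟶ ModuleCat.of R (boundaries K i) :=
  ModuleCat.ofHom (K.d (i + 1) i).hom.rangeRestrict

variable {K : ChainComplex (ModuleCat.{u} R) ℕ} {X : ModuleCat.{u} R} {p : K.X 0 ⟶ X}

lemma IsResolution.d_comp (h : IsResolution K p) : K.d 1 0 ≫ p = 0 := by
  ext1
  apply LinearMap.ext
  exact h.exact_zero.apply_apply_eq_zero

lemma IsResolution.ker_eq (h : IsResolution K p) : LinearMap.ker p.hom = boundaries K 0 :=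
  h.exact_zero.linearMap_ker_eq

lemma IsResolution.ker_toBoundaries (h : IsResolution K p) (i : ℕ) :
    LinearMap.ker (toBoundaries K i).hom = boundaries K (i + 1) :=
  (LinearMap.ker_rangeRestrict _).trans (h.exact_succ i).linearMap_ker_eq

lemma IsResolution.shortExact_zero (h : IsResolution K p) :
    (ShortComplex.mk _ _ (subtype_comp_eq_zero _ _ h.ker_eq)).ShortExact :=
  shortExact_subtype _ _ h.ker_eq h.surjective

lemma IsResolution.shortExact_succ (h : IsResolution K p) (i : ℕ) :
    (ShortComplex.mk _ _ (subtype_comp_eq_zero _ _ (h.ker_toBoundaries i))).ShortExact :=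
  shortExact_subtype _ _ (h.ker_toBoundaries i) (LinearMap.surjective_rangeRestrict _)

/-- The element `a` annihilates `Ext^n(X, Z)` for all finitely generated modules `Z`. -/
def KillsExt (a : R) (X : ModuleCat.{u} R) (n : ℕ) : Prop :=
  ∀ (Z : ModuleCat.{u} R) [Module.Finite R Z] (e : Abelian.Ext X Z n), a • e = 0

/-- As `X₂` is projective, the connecting map `Ext^{n+1}(X₁, Z) → Ext^{n+2}(X₃, Z)` is injective. -/
lemma KillsExt.of_shortExact {a : R} {S : ShortComplex (ModuleCat.{u} R)} (hS : S.ShortExact)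
    [Projective S.X₂] {n : ℕ} (h : KillsExt a S.X₃ (n + 2)) : KillsExt a S.X₁ (n + 1) := by
  intro Z _ e
  have h₁ : hS.extClass.comp (a • e) (add_comm 1 (n + 1)) = 0 := by
    rw [Abelian.Ext.comp_smul]
    exact h Z _
  obtain ⟨e', he'⟩ := Abelian.Ext.contravariant_sequence_exact₁ hS Z (a • e)
    (add_comm 1 (n + 1)) h₁
  rw [← he', Abelian.Ext.eq_zero_of_projective e', Abelian.Ext.comp_zero]

/-- The connecting map sends `a • 𝟙` to `a` times the extension class, which is zero; exactness
extends `a • 𝟙` to `X₂`. -/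
lemma KillsExt.exists_retraction {a : R} {S : ShortComplex (ModuleCat.{u} R)} (hS : S.ShortExact)
    [Module.Finite R S.X₁] (h : KillsExt a S.X₃ 1) :
    ∃ r : S.X₂ ⟶ S.X₁, S.f ≫ r = a • 𝟙 S.X₁ := by
  have h₁ : hS.extClass.comp (Abelian.Ext.mk₀ (a • 𝟙 S.X₁)) (add_zero 1) = 0 := by
    rw [Abelian.Ext.mk₀_smul, Abelian.Ext.comp_smul]
    exact h _ _
  obtain ⟨e, he⟩ := Abelian.Ext.contravariant_sequence_exact₁ hS S.X₁ _ (add_zero 1) h₁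
  obtain ⟨r, rfl⟩ := (Abelian.Ext.mk₀_bijective _ _).2 e
  refine ⟨r, ?_⟩
  rw [Abelian.Ext.mk₀_comp_mk₀] at he
  exact (Abelian.Ext.mk₀_bijective _ _).1 he

/-- The module `boundaries K i` is the `(i + 1)`-st syzygy of `X`, so `i + 1` dimension shifts
apply. -/
lemma IsResolution.killsExt_boundaries (h : IsResolution K p) [∀ i, Module.Free R (K.X i)] {a : R}
    (i n : ℕ) (ha : KillsExt a X (i + n + 2)) :
    KillsExt a (ModuleCat.of R (boundaries K i)) (n + 1) := by
  induction i generalizing n with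
  | zero =>
    rw [zero_add] at ha
    have : Projective (K.X 0) := ModuleCat.projective_of_free (Module.Free.chooseBasis R (K.X 0))
    exact KillsExt.of_shortExact h.shortExact_zero ha
  | succ i ih =>
    have : Projective (K.X (i + 1)) :=
      ModuleCat.projective_of_free (Module.Free.chooseBasis R (K.X (i + 1)))
    refine KillsExt.of_shortExact (h.shortExact_succ i) (ih (n + 1) ?_)
    rwa [show i + (n + 1) + 2 = i + 1 + n + 2 by ring]

/-- If `a` kills the modules `Ext^{i+2}(X, -)`, then multiplication by `a` on a free resolution of
`X` is null-homotopic in degree `i + 2`. -/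
lemma IsResolution.mem_minorsIdeal_sup (h : IsResolution K p) [∀ i, Module.Free R (K.X i)]
    [∀ i, Module.Finite R (K.X i)] {a : R} (i : ℕ) (ha : KillsExt a X (i + 2)) :
    a ∈ minorsIdeal 1 (K.d (i + 3) (i + 2)).hom ⊔ minorsIdeal 1 (K.d (i + 2) (i + 1)).hom := by
  have : Module.Finite R (ModuleCat.of R (boundaries K (i + 1))) :=
    inferInstanceAs (Module.Finite R (LinearMap.range _))
  obtain ⟨r, hr⟩ := KillsExt.exists_retraction (h.shortExact_succ i)
    (h.killsExt_boundaries i 0 ha)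
  have hr' (z : boundaries K (i + 1)) : r.hom (z : K.X (i + 1)) = a • z :=
    congr($hr z)
  obtain ⟨s, hs⟩ := Module.projective_lifting_property (K.d (i + 2) (i + 1)).hom.rangeRestrict
    r.hom (LinearMap.surjective_rangeRestrict _)
  have hs' (y : K.X (i + 1)) : (K.d (i + 2) (i + 1)).hom (s y) = (r.hom y : boundaries K (i + 1)) :=
    congr(((($hs y : boundaries K (i + 1))) : K.X (i + 1)))
  -- Since `d s d = r d = a d`, the map `a - s d` lands in `ker d`, the next boundaries, and lifts
  -- to the other half `s'` of the homotopy.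
  let t : K.X (i + 2) →ₗ[R] K.X (i + 2) := a • LinearMap.id - s ∘ₗ (K.d (i + 2) (i + 1)).hom
  have ht (x) : t x ∈ boundaries K (i + 2) := by
    refine (h.exact_succ (i + 1) (t x)).mp ?_
    have := hr' ⟨(K.d (i + 2) (i + 1)).hom x, x, rfl⟩
    simp only [t, LinearMap.sub_apply, LinearMap.smul_apply, LinearMap.comp_apply, map_sub,
      LinearMap.id_apply, map_smul, hs', this, Submodule.coe_smul, sub_self]
  obtain ⟨s', hs''⟩ := Module.projective_lifting_property (K.d (i + 3) (i + 2)).hom.rangeRestrict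
    (t.codRestrict _ ht) (LinearMap.surjective_rangeRestrict _)
  refine mem_minorsIdeal_sup_of_homotopy _ _ s' s a fun x ↦ ?_
  have : (K.d (i + 3) (i + 2)).hom (s' x) = t x :=
    congr(((($hs'' x : boundaries K (i + 2))) : K.X (i + 2)))
  rw [this]
  simp [t]

lemma killsExt_of_mem_annihilator {a : R} (X : ModuleCat.{u} R) (ha : a ∈ Module.annihilator R X)
    (n : ℕ) : KillsExt a X n := by
  intro Z _ e
  have : a • 𝟙 X = 0 := by
    ext x
    exact Module.mem_annihilator.mp ha x
  have h₂ : (Abelian.Ext.mk₀ (a • 𝟙 X)).comp e (zero_add n) = a • e := by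
    rw [Abelian.Ext.mk₀_smul, Abelian.Ext.smul_comp, Abelian.Ext.mk₀_id_comp]
  rw [← h₂, this, Abelian.Ext.mk₀_zero, Abelian.Ext.zero_comp]

lemma killsExt_of_mem_caN {a : R} {n i : ℕ} (ha : a ∈ caN R n) (hi : n ≤ i) (X : ModuleCat.{u} R)
    [Module.Finite R X] : KillsExt a X i := by
  intro Z _ e
  simp only [caN, Submodule.mem_iInf] at ha
  exact Module.mem_annihilator.mp (ha X Z ‹_› ‹_› i hi) e

lemma killsExt_of_hasProjectiveDimensionLT (a : R) (X : ModuleCat.{u} R) (n : ℕ)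
    [HasProjectiveDimensionLT X n] {i : ℕ} (hi : n ≤ i) : KillsExt a X i := by
  intro Z _ e
  rw [Abelian.Ext.eq_zero_of_hasProjectiveDimensionLT e n hi, smul_zero]

/-- If a term of a resolution by projective modules vanishes, then the projective dimension is
finite. -/
lemma IsResolution.hasProjectiveDimensionLT_of_isZero (h : IsResolution K p)
    [∀ i, Module.Free R (K.X i)] (i : ℕ) (hi : IsZero (K.X i)) :
    HasProjectiveDimensionLT X (i + 1) := by
  have hp (j) : HasProjectiveDimensionLT (K.X j) 1 := by
    have : Projective (K.X j) := ModuleCat.projective_of_free (Module.Free.chooseBasis R (K.X j))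
    infer_instance
  -- The boundaries in degree `i` vanish with `K_i`; each step down to degree `j` costs one in the
  -- bound.
  have key (j n : ℕ) (hjn : i = j + n) :
      HasProjectiveDimensionLT (ModuleCat.of R (boundaries K j)) n := by
    induction n generalizing j with
    | zero =>
      obtain rfl : i = j := hjn
      have := ModuleCat.subsingleton_of_isZero hi
      exact (ModuleCat.isZero_of_subsingleton _).hasProjectiveDimensionLT_zero
    | succ n ih =>
      exact (h.shortExact_succ j).hasProjectiveDimensionLT_X₃ n (ih (j + 1) (by omega))
        (hasProjectiveDimensionLT_of_ge _ 1 _ (by omega))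
  exact h.shortExact_zero.hasProjectiveDimensionLT_X₃ i (key 0 i (by omega))
    (hasProjectiveDimensionLT_of_ge _ 1 _ (by omega))

end Resolutions

/-! ### Passing between resolutions of complexes and of modules. -/

section Comparison

variable {R : Type u} [CommRing R]

lemma exactAt_iff_function_exact {F : ChainComplex (ModuleCat.{u} R) ℤ} (i j k : ℤ)
    (hi : i = j + 1) (hk : k + 1 = j) :
    F.ExactAt j ↔ Function.Exact (F.d i j).hom (F.d j k).hom := by
  rw [F.exactAt_iff' i j k (by simp [hi]) ((ComplexShape.down ℤ).next_eq' hk),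
    ShortComplex.ShortExact.moduleCat_exact_iff_function_exact]
  exact Iff.rfl

lemma natExactAt_iff_function_exact {K : ChainComplex (ModuleCat.{u} R) ℕ} (j : ℕ) :
    K.ExactAt (j + 1) ↔ Function.Exact (K.d (j + 2) (j + 1)).hom (K.d (j + 1) j).hom := by
  rw [K.exactAt_iff' (j + 2) (j + 1) j (by simp) (by simp),
    ShortComplex.ShortExact.moduleCat_exact_iff_function_exact]
  exact Iff.rfl

lemma restrictGE_exact {F : ChainComplex (ModuleCat.{u} R) ℤ} {n : ℤ} {i : ℕ}
    (h : F.ExactAt (n + i + 1)) :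
    Function.Exact ((restrictGE F n).d (i + 2) (i + 1)).hom
      ((restrictGE F n).d (i + 1) i).hom := by
  have : n + i + 1 = n + (i + 1 : ℕ) := by push_cast; ring
  rw [this, exactAt_iff_function_exact (n + (i + 2 : ℕ)) _ (n + i) (by push_cast; ring)
    (by push_cast; ring)] at h
  exact h

/-- The augmentation of the part of a complex in degrees `≥ n` to the cokernel of the last
differential. -/
noncomputable abbrev augmentationGE (F : ChainComplex (ModuleCat.{u} R) ℤ) (n : ℤ) :
    (restrictGE F n).X 0 ⟶ ModuleCat.of R ((restrictGE F n).X 0 ⧸ boundaries (restrictGE F n) 0) :=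
  ModuleCat.ofHom (Submodule.mkQ _)

lemma isResolution_restrictGE {F : ChainComplex (ModuleCat.{u} R) ℤ} {n : ℤ}
    (h : ∀ i > n, F.ExactAt i) : IsResolution (restrictGE F n) (augmentationGE F n) where
  surjective := Submodule.mkQ_surjective _
  exact_zero := LinearMap.exact_iff.mpr (Submodule.ker_mkQ _)
  exact_succ i := restrictGE_exact (h _ (by omega))

lemma mem_totalIdeal_of_killsExt {F : ChainComplex (ModuleCat.{u} R) ℤ}
    [∀ i, Module.Free R (F.X i)] [∀ i, Module.Finite R (F.X i)] {N : ℤ} {X : ModuleCat.{u} R}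
    {p : (restrictGE F N).X 0 ⟶ X} (h : IsResolution (restrictGE F N) p) {a : R} (s : ℕ)
    (ha : ∀ i ≥ s, KillsExt a X i) (n : ℤ) : a ∈ totalIdeal (truncGE F n) 1 := by
  refine mem_totalIdeal_truncGE F a 1 (fun b ↦ ?_) n
  have hfree (i) : Module.Free R ((restrictGE F N).X i) :=
    inferInstanceAs (Module.Free R (F.X _))
  have hfin (i) : Module.Finite R ((restrictGE F N).X i) :=
    inferInstanceAs (Module.Finite R (F.X _))
  -- This makes the Ext degree `i + 2` at least `s` and the complex degree `N + i + 2` at least `b`.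
  let i : ℕ := s + (b - N).toNat
  refine ⟨N + (i + 2 : ℕ), by omega, ?_⟩
  have h₁ : N + (i + 2 : ℕ) + 1 = N + (i + 3 : ℕ) := by push_cast; ring
  have h₂ : N + (i + 2 : ℕ) - 1 = N + (i + 1 : ℕ) := by push_cast; ring
  rw [h₁, h₂]
  exact h.mem_minorsIdeal_sup i (ha (i + 2) (by omega))

lemma IsResolution.quasiIso {K : ChainComplex (ModuleCat.{u} R) ℕ} {L : ModuleCat.{u} R}
    {p : K.X 0 ⟶ L} (h : IsResolution K p) (hp : K.d 1 0 ≫ p = 0) :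
    QuasiIso ((ChainComplex.toSingle₀Equiv K L).symm ⟨p, hp⟩) where
  quasiIsoAt i := by
    cases i with
    | zero =>
      rw [ChainComplex.quasiIsoAt₀_iff, ShortComplex.quasiIso_iff_of_zeros']
      · constructor
        · apply ModuleCat.shortComplex_exact
          change Function.Exact (K.d 1 0).hom
            (((ChainComplex.toSingle₀Equiv K L).symm ⟨p, hp⟩).f 0).hom
          rw [ChainComplex.toSingle₀Equiv_symm_apply_f_zero]
          exact h.exact_zero
        · rw [ModuleCat.epi_iff_surjective]
          change Function.Surjective (((ChainComplex.toSingle₀Equiv K L).symm ⟨p, hp⟩).f 0).hom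
          rw [ChainComplex.toSingle₀Equiv_symm_apply_f_zero]
          exact h.surjective
      · exact K.shape _ _ (by simp)
      · exact HomologicalComplex.single_obj_d (ComplexShape.down ℕ) _ _ _ _
      · exact HomologicalComplex.single_obj_d (ComplexShape.down ℕ) _ _ _ _
    | succ i =>
      rw [quasiIsoAt_iff_exactAt']
      · exact (natExactAt_iff_function_exact i).mpr (h.exact_succ i)
      · exact HomologicalComplex.exactAt_single_obj _ _ _ _ (by simp)

/-- The map from a resolution of `L` to `L`, as complexes indexed by the integers. -/
noncomputable def toModuleComplex {K : ChainComplex (ModuleCat.{u} R) ℕ} {L : ModuleCat.{u} R}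
    (p : K.X 0 ⟶ L) (hp : K.d 1 0 ≫ p = 0) : K.extend (embeddingGE 0) ⟶ moduleComplex L :=
  HomologicalComplex.extendMap ((ChainComplex.toSingle₀Equiv K L).symm ⟨p, hp⟩) (embeddingGE 0) ≫
    (HomologicalComplex.extendSingleIso (embeddingGE 0) L 0 0 (by simp [embeddingGE_f])).hom

lemma isCPlusF_moduleComplex (L : ModuleCat.{u} R) [Module.Finite R L] :
    IsCPlusF (moduleComplex L) where
  finite i := by
    by_cases hi : i = 0
    · subst hi
      exact Module.Finite.equiv
        (HomologicalComplex.singleObjXSelf (ComplexShape.down ℤ) 0 L).symm.toLinearEquiv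
    · have : Subsingleton ((moduleComplex L).X i) := ModuleCat.subsingleton_of_isZero
        (HomologicalComplex.isZero_single_obj_X (ComplexShape.down ℤ) 0 L i hi)
      infer_instance
  boundedBelow := ⟨0, fun i hi ↦ HomologicalComplex.isZero_single_obj_X _ _ _ _ (by omega)⟩
  boundedHomology := ⟨0, fun i hi ↦ (HomologicalComplex.exactAt_single_obj
    (ComplexShape.down ℤ) 0 L i (by omega)).isZero_homology⟩

variable [IsLocalRing R]

lemma range_extend_le {K : ChainComplex (ModuleCat.{u} R) ℕ} (n : ℤ)
    (h : ∀ i, LinearMap.range (K.d (i + 1) i).hom ≤ maximalIdeal R • (⊤ : Submodule R (K.X i)))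
    (i j : ℤ) : LinearMap.range ((K.extend (embeddingGE n)).d i j).hom ≤
      maximalIdeal R • (⊤ : Submodule R ((K.extend (embeddingGE n)).X j)) := by
  by_cases hij : j + 1 = i
  swap
  · rw [HomologicalComplex.shape _ _ _ hij]
    simp
  by_cases hj : j < n
  · have := (isZero_extend_embeddingGE K n j hj).eq_zero_of_tgt
      ((K.extend (embeddingGE n)).d i j)
    rw [this]
    simp
  obtain ⟨t, ht⟩ := Int.le.dest (not_lt.mp hj)
  have hi' : (embeddingGE n).f (t + 1) = i := by rw [embeddingGE_f]; push_cast; omega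
  have hj' : (embeddingGE n).f t = j := ht
  rw [K.extend_d_eq _ hi' hj']
  rintro _ ⟨x, rfl⟩
  have h₁ := h t ⟨(K.extendXIso (embeddingGE n) hi').hom.hom x, rfl⟩
  have h₂ := Submodule.mem_map_of_mem (f := (K.extendXIso (embeddingGE n) hj').inv.hom) h₁
  rw [Submodule.map_smul''] at h₂
  exact Submodule.smul_mono le_rfl le_top h₂

lemma IsResolution.isMinimalFreeResolution {K : ChainComplex (ModuleCat.{u} R) ℕ}
    {L : ModuleCat.{u} R} {p : K.X 0 ⟶ L} (h : IsResolution K p) (hp : K.d 1 0 ≫ p = 0)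
    [hfree : ∀ i, Module.Free R (K.X i)] [hfin : ∀ i, Module.Finite R (K.X i)]
    (hK : ∀ i, LinearMap.range (K.d (i + 1) i).hom ≤ maximalIdeal R • (⊤ : Submodule R (K.X i))) :
    IsMinimalFreeResolution (toModuleComplex p hp) where
  free i := by
    by_cases hi : i < 0
    · have := ModuleCat.subsingleton_of_isZero (isZero_extend_embeddingGE K 0 i hi)
      infer_instance
    · obtain ⟨t, ht⟩ := Int.le.dest (not_lt.mp hi)
      exact Module.Free.of_equiv (K.extendXIso (embeddingGE 0) (i := t) ht).symm.toLinearEquiv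
  finite i := by
    by_cases hi : i < 0
    · have := ModuleCat.subsingleton_of_isZero (isZero_extend_embeddingGE K 0 i hi)
      infer_instance
    · obtain ⟨t, ht⟩ := Int.le.dest (not_lt.mp hi)
      exact Module.Finite.equiv (K.extendXIso (embeddingGE 0) (i := t) ht).symm.toLinearEquiv
  boundedBelow := ⟨0, isZero_extend_embeddingGE K 0⟩
  minimal := range_extend_le 0 hK
  quasiIso := by
    have := h.quasiIso hp
    have h₁ : QuasiIso (HomologicalComplex.extendMap
        ((ChainComplex.toSingle₀Equiv K L).symm ⟨p, hp⟩) (embeddingGE 0)) := inferInstance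
    have h₂ : QuasiIso (HomologicalComplex.extendSingleIso (embeddingGE 0) L 0 0
      (by simp [embeddingGE_f])).hom := ⟨fun i ↦ quasiIsoAt_of_isIso _ i⟩
    unfold toModuleComplex moduleComplex
    exact quasiIso_comp _ _

/-- Nakayama, upwards from the lower bound: if `F_{i-1} = 0` and `i < 0`, exactness and minimality
give `F_i = im d_{i+1} ⊆ 𝔪 F_i`. -/
lemma IsMinimalFreeResolution.isZero_of_neg {F : ChainComplex (ModuleCat.{u} R) ℤ}
    {L : ModuleCat.{u} R} {f : F ⟶ moduleComplex L} (h : IsMinimalFreeResolution f) {i : ℤ}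
    (hi : i < 0) : IsZero (F.X i) := by
  obtain ⟨a, ha⟩ := h.boundedBelow
  have := h.quasiIso
  have key (n : ℕ) : ∀ i < 0, i < a + n → IsZero (F.X i) := by
    induction n with
    | zero => exact fun i _ hi ↦ ha i (by simpa using hi)
    | succ n ih =>
      intro i hi hin
      have hex : F.ExactAt i := by
        rw [exactAt_iff_of_quasiIsoAt f i]
        exact HomologicalComplex.exactAt_single_obj _ _ _ _ (by omega)
      rw [exactAt_iff_function_exact (i + 1) i (i - 1) rfl (by ring)] at hex
      have hz : F.d i (i - 1) = 0 :=
        (ih (i - 1) (by omega) (by push_cast at hin; omega)).eq_zero_of_tgt _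
      have htop : (⊤ : Submodule R (F.X i)) ≤ maximalIdeal R • ⊤ := by
        refine le_trans ?_ (h.minimal (i + 1) i)
        intro x _
        exact (hex x).mp (by simp [hz])
      have := h.finite i
      have hbot := Submodule.eq_bot_of_le_smul_of_le_jacobson_bot (maximalIdeal R) _
        Module.Finite.fg_top htop (maximalIdeal_le_jacobson _)
      rw [ModuleCat.isZero_iff_subsingleton]
      exact (Submodule.subsingleton_iff R).mp (subsingleton_of_bot_eq_top hbot.symm)
  exact key (i + 1 - a).toNat i hi (by omega)

/-- The augmentation of a complex mapping to a module. -/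
noncomputable def augmentation {F : ChainComplex (ModuleCat.{u} R) ℤ}
    {L : ModuleCat.{u} R} (f : F ⟶ moduleComplex L) : (restrictGE F 0).X 0 ⟶ L :=
  (f.f 0 : F.X 0 ⟶ (moduleComplex L).X 0) ≫
    (HomologicalComplex.singleObjXSelf (ComplexShape.down ℤ) 0 L).hom

/-- Because `F_{-1} = 0`, a quasi-isomorphism in degree `0` amounts to exactness of `F_1 → F_0 → L →
0`. -/
lemma IsMinimalFreeResolution.isResolution {F : ChainComplex (ModuleCat.{u} R) ℤ}
    {L : ModuleCat.{u} R} {f : F ⟶ moduleComplex L} (h : IsMinimalFreeResolution f) :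
    IsResolution (restrictGE F 0) (augmentation f) := by
  have := h.quasiIso
  have h0 : QuasiIsoAt f 0 := inferInstance
  rw [quasiIsoAt_iff' f 1 0 (-1) (by simp) (by simp), ShortComplex.quasiIso_iff_of_zeros'] at h0
  rotate_left
  · exact (h.isZero_of_neg (by omega)).eq_zero_of_tgt _
  · exact HomologicalComplex.single_obj_d (ComplexShape.down ℤ) _ _ _ _
  · exact HomologicalComplex.single_obj_d (ComplexShape.down ℤ) _ _ _ _
  obtain ⟨h₁, h₂⟩ := h0
  rw [ShortComplex.ShortExact.moduleCat_exact_iff_function_exact] at h₁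
  rw [ModuleCat.epi_iff_surjective] at h₂
  let e := (HomologicalComplex.singleObjXSelf (ComplexShape.down ℤ) 0 L).toLinearEquiv
  refine ⟨e.surjective.comp h₂, ?_, fun i ↦ restrictGE_exact ?_⟩
  · change Function.Exact (F.d 1 0).hom (e.toLinearMap ∘ₗ (f.f 0).hom)
    exact h₁.comp_injective _ e.injective (map_zero e)
  · rw [exactAt_iff_of_quasiIsoAt f]
    exact HomologicalComplex.exactAt_single_obj _ _ _ _ (by omega)

end Comparison

/-! ### Minimal resolutions and bounds for stable ideals. -/

section Existence

variable {R : Type u} [CommRing R] [IsLocalRing R]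

/-- Lift a basis of `k ⊗ M`: Nakayama gives surjectivity, and a relation reduces to one among basis
vectors, so its coefficients lie in `𝔪`. -/
lemma exists_minimal_cover (M : Type u) [AddCommGroup M] [Module R M] [Module.Finite R M] :
    ∃ (n : ℕ) (f : (Fin n → R) →ₗ[R] M), Function.Surjective f ∧
      LinearMap.ker f ≤ maximalIdeal R • (⊤ : Submodule R (Fin n → R)) := by
  let b := Module.finBasis (ResidueField R) (TensorProduct R (ResidueField R) M)
  have hsurj : Function.Surjective (TensorProduct.mk R (ResidueField R) M 1) :=
    TensorProduct.mk_surjective R M (ResidueField R) residue_surjective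
  choose v hv using fun i ↦ hsurj (b i)
  refine ⟨_, Fintype.linearCombination R v, ?_, ?_⟩
  · rw [← LinearMap.range_eq_top, Fintype.range_linearCombination]
    exact span_eq_top_of_tmul_eq_basis v b hv
  · intro w hw
    have h₁ : ∑ i, residue R (w i) • b i = 0 := by
      have := congrArg (TensorProduct.mk R (ResidueField R) M 1) (LinearMap.mem_ker.mp hw)
      rw [Fintype.linearCombination_apply, map_sum, map_zero] at this
      rw [← this]
      refine Finset.sum_congr rfl fun i _ ↦ ?_
      rw [map_smul, hv]
      exact (algebraMap_smul (ResidueField R) (w i) (b i))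
    have h₂ := Fintype.linearIndependent_iff.mp b.linearIndependent _ h₁
    rw [pi_eq_sum_univ w]
    refine Submodule.sum_mem _ fun i _ ↦ Submodule.smul_mem_smul ?_ trivial
    exact (residue_eq_zero_iff _).mp (h₂ i)

variable (R) in
/-- A finitely generated module over `R`. -/
abbrev FGMod : Type (u + 1) := {M : ModuleCat.{u} R // Module.Finite R M}

instance (M : FGMod R) : Module.Finite R M.1 := M.2

/-- The minimal number of generators. -/
noncomputable def coverRank (M : FGMod R) : ℕ := (exists_minimal_cover (R := R) M.1).choose

/-- A minimal free cover. -/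
noncomputable def coverMap (M : FGMod R) : (Fin (coverRank M) → R) →ₗ[R] M.1 :=
  (exists_minimal_cover (R := R) M.1).choose_spec.choose

lemma coverMap_surjective (M : FGMod R) : Function.Surjective (coverMap M) :=
  (exists_minimal_cover (R := R) M.1).choose_spec.choose_spec.1

lemma ker_coverMap_le (M : FGMod R) : LinearMap.ker (coverMap M) ≤
    maximalIdeal R • (⊤ : Submodule R (Fin (coverRank M) → R)) :=
  (exists_minimal_cover (R := R) M.1).choose_spec.choose_spec.2

/-- Elements that annihilate the high `Ext` modules out of `L` lie in the stable ideal of `L`. -/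
lemma mem_Istab_moduleComplex (L : ModuleCat.{u} R) (a : R) (s : ℕ)
    (ha : ∀ i ≥ s, KillsExt a L i) : a ∈ Istab (moduleComplex L) 1 := by
  simp only [Istab, stableIdeal, Submodule.mem_iInf]
  intro F f hf n _
  have := hf.free
  have := hf.finite
  exact mem_totalIdeal_of_killsExt hf.isResolution s ha n

lemma Istab_eq_top_of_projectiveDimension_ne_top (L : ModuleCat.{u} R)
    (h : projectiveDimension L ≠ ⊤) : Istab (moduleComplex L) 1 = ⊤ := by
  obtain ⟨n, hn⟩ := (projectiveDimension_ne_top_iff L).mp h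
  rw [Ideal.eq_top_iff_one]
  exact mem_Istab_moduleComplex L 1 (n + 1) fun i hi ↦ killsExt_of_hasProjectiveDimensionLT 1 L _ hi

lemma annihilator_le_Istab (L : ModuleCat.{u} R) :
    Module.annihilator R L ≤ Istab (moduleComplex L) 1 := fun a ha ↦
  mem_Istab_moduleComplex L a 0 fun i _ ↦ killsExt_of_mem_annihilator L ha i

lemma IsMinimalFreeResolution.exactAt {F M : ChainComplex (ModuleCat.{u} R) ℤ} {f : F ⟶ M}
    (h : IsMinimalFreeResolution f) {b : ℤ} (hb : ∀ i > b, IsZero (M.homology i)) :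
    ∀ i > b, F.ExactAt i := by
  intro i hi
  have := h.quasiIso
  rw [exactAt_iff_of_quasiIsoAt f, HomologicalComplex.exactAt_iff_isZero_homology]
  exact hb i hi

/-- The chain `𝔪^n L` stabilizes, and Nakayama makes its stable value zero. -/
lemma exists_maximalIdeal_pow_le_annihilator (L : Type u) [AddCommGroup L] [Module R L]
    (h : IsFiniteLength R L) : ∃ n, maximalIdeal R ^ n ≤ Module.annihilator R L := by
  obtain ⟨h₁, h₂⟩ := isFiniteLength_iff_isNoetherian_isArtinian.mp h
  let f : ℕ →o (Submodule R L)ᵒᵈ :=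
    ⟨fun n ↦ OrderDual.toDual (maximalIdeal R ^ n • ⊤), fun a b hab ↦
      Submodule.smul_mono (Ideal.pow_le_pow_right hab) le_rfl⟩
  obtain ⟨n, hn⟩ := IsArtinian.monotone_stabilizes f
  have h₃ : maximalIdeal R ^ n • (⊤ : Submodule R L) = maximalIdeal R ^ (n + 1) • ⊤ :=
    hn (n + 1) (by omega)
  have h₄ := Submodule.eq_bot_of_le_smul_of_le_jacobson_bot (maximalIdeal R)
    (maximalIdeal R ^ n • (⊤ : Submodule R L)) (IsNoetherian.noetherian _)
    (by rw [← Submodule.mul_smul, ← pow_succ']; exact h₃.le) (maximalIdeal_le_jacobson _)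
  refine ⟨n, fun a ha ↦ Module.mem_annihilator.mpr fun x ↦ ?_⟩
  have : a • x ∈ maximalIdeal R ^ n • (⊤ : Submodule R L) := Submodule.smul_mem_smul ha trivial
  rwa [h₄] at this

lemma IsMinimalFreeResolution.ca_le_totalIdeal_truncGE {F M : ChainComplex (ModuleCat.{u} R) ℤ}
    {f : F ⟶ M} (h : IsMinimalFreeResolution f) (hM : IsCPlusF M) (n : ℤ) :
    ca R ≤ totalIdeal (truncGE F n) 1 := by
  intro a ha
  obtain ⟨s, hs⟩ := mem_ca.mp ha
  obtain ⟨b, hb⟩ := hM.boundedHomology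
  have := h.free
  have := h.finite
  have hfin : Module.Finite R ((restrictGE F b).X 0) := h.finite _
  have : Module.Finite R (ModuleCat.of R ((restrictGE F b).X 0 ⧸ boundaries (restrictGE F b) 0)) :=
    inferInstanceAs (Module.Finite R ((restrictGE F b).X 0 ⧸ boundaries (restrictGE F b) 0))
  exact mem_totalIdeal_of_killsExt (isResolution_restrictGE (h.exactAt hb)) s
    (fun i hi ↦ killsExt_of_mem_caN hs hi _) n

lemma ca_le_Istab {M : ChainComplex (ModuleCat.{u} R) ℤ} (hM : IsCPlusF M) :
    ca R ≤ Istab M 1 :=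
  le_iInf fun _ ↦ le_iInf₂ fun _ hf ↦ le_iInf₂ fun n _ ↦ hf.ca_le_totalIdeal_truncGE hM n

lemma ca_le_IstabCPlusF : ca R ≤ IstabCPlusF R 1 :=
  le_iInf₂ fun _ hM ↦ le_iInf fun _ ↦ le_iInf₂ fun _ hf ↦
    (hf.ca_le_totalIdeal_truncGE hM 0).trans (totalIdeal_truncGE_le _ _ _)

/-- Above the homology, the truncation of `F` is a minimal resolution of a cokernel, and its total
ideal is contained in that of `F`. -/
lemma IstabMod_le_IstabCPlusF : IstabMod R 1 ≤ IstabCPlusF R 1 := by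
  refine le_iInf₂ fun M hM ↦ le_iInf fun F ↦ le_iInf₂ fun f hf ↦ ?_
  obtain ⟨b, hb⟩ := hM.boundedHomology
  have hfin : Module.Finite R ((restrictGE F b).X 0) := hf.finite _
  have : Module.Finite R (ModuleCat.of R ((restrictGE F b).X 0 ⧸ boundaries (restrictGE F b) 0)) :=
    inferInstanceAs (Module.Finite R ((restrictGE F b).X 0 ⧸ boundaries (restrictGE F b) 0))
  have hres := isResolution_restrictGE (hf.exactAt hb)
  have h₁ := hres.isMinimalFreeResolution hres.d_comp (hfree := fun i ↦ hf.free _)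
    (hfin := fun i ↦ hf.finite _) (fun i ↦ hf.minimal _ _)
  refine iInf₂_le_of_le _ this <| iInf_le_of_le _ <| iInf₂_le_of_le _ h₁ ?_
  rw [totalIdeal_extend, ← totalIdeal_truncGE]
  exact totalIdeal_truncGE_le _ _ _

lemma IstabCPlusF_eq_IstabMod : IstabCPlusF R 1 = IstabMod R 1 :=
  le_antisymm (le_iInf₂ fun L _ ↦ iInf₂_le _ (isCPlusF_moduleComplex L)) IstabMod_le_IstabCPlusF

variable [IsNoetherianRing R]

/-- The iterated syzygies of a finitely generated module. -/
noncomputable def syzygy (M : FGMod R) : ℕ → FGMod R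
  | 0 => M
  | n + 1 => ⟨ModuleCat.of R (LinearMap.ker (coverMap (syzygy M n))),
      inferInstanceAs (Module.Finite R (LinearMap.ker _))⟩

/-- The inclusion of a syzygy into the free cover of the preceding one. -/
noncomputable def syzygyInclusion (M : FGMod R) (n : ℕ) :
    (syzygy M (n + 1)).1 →ₗ[R] (Fin (coverRank (syzygy M n)) → R) :=
  (LinearMap.ker (coverMap (syzygy M n))).subtype

lemma range_syzygyInclusion (M : FGMod R) (n : ℕ) :
    LinearMap.range (syzygyInclusion M n) = LinearMap.ker (coverMap (syzygy M n)) :=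
  Submodule.range_subtype _

lemma ker_syzygyInclusion (M : FGMod R) (n : ℕ) : LinearMap.ker (syzygyInclusion M n) = ⊥ :=
  Submodule.ker_subtype _

/-- The differentials of the minimal free resolution built from the syzygies. -/
noncomputable def minimalD (M : FGMod R) (n : ℕ) :
    (Fin (coverRank (syzygy M (n + 1))) → R) →ₗ[R] (Fin (coverRank (syzygy M n)) → R) :=
  syzygyInclusion M n ∘ₗ coverMap (syzygy M (n + 1))

lemma range_minimalD (M : FGMod R) (n : ℕ) :
    LinearMap.range (minimalD M n) = LinearMap.ker (coverMap (syzygy M n)) := by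
  rw [minimalD, LinearMap.range_comp, LinearMap.range_eq_top.mpr (coverMap_surjective _),
    Submodule.map_top, range_syzygyInclusion]

lemma ker_minimalD (M : FGMod R) (n : ℕ) :
    LinearMap.ker (minimalD M n) = LinearMap.ker (coverMap (syzygy M (n + 1))) := by
  rw [minimalD, LinearMap.ker_comp, ker_syzygyInclusion]
  rfl

/-- A minimal free resolution of a finitely generated module. -/
noncomputable def minimalComplex (M : FGMod R) : ChainComplex (ModuleCat.{u} R) ℕ :=
  ChainComplex.of (fun n ↦ ModuleCat.of R (Fin (coverRank (syzygy M n)) → R))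
    (fun n ↦ ModuleCat.ofHom (minimalD M n)) fun n ↦ by
      ext1
      apply LinearMap.ext
      intro x
      have : minimalD M (n + 1) x ∈ LinearMap.ker (minimalD M n) := by
        rw [ker_minimalD, ← range_minimalD]
        exact ⟨x, rfl⟩
      exact this

lemma minimalComplex_d (M : FGMod R) (n : ℕ) :
    ((minimalComplex M).d (n + 1) n).hom = minimalD M n :=
  congrArg ModuleCat.Hom.hom (ChainComplex.of_d
    (fun n ↦ ModuleCat.of R (Fin (coverRank (syzygy M n)) → R))
    (fun n ↦ ModuleCat.ofHom (minimalD M n)) n)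

instance (M : FGMod R) (i : ℕ) : Module.Free R ((minimalComplex M).X i) :=
  inferInstanceAs (Module.Free R (Fin _ → R))

instance (M : FGMod R) (i : ℕ) : Module.Finite R ((minimalComplex M).X i) :=
  inferInstanceAs (Module.Finite R (Fin _ → R))

/-- The augmentation of the minimal free resolution. -/
noncomputable def minimalAugmentation (M : FGMod R) : (minimalComplex M).X 0 ⟶ M.1 :=
  ModuleCat.ofHom (coverMap M)

lemma isResolution_minimalComplex (M : FGMod R) : IsResolution _ (minimalAugmentation M) where
  surjective := coverMap_surjective M
  exact_zero := by
    have : Function.Exact (minimalD M 0) (coverMap M) :=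
      LinearMap.exact_iff.mpr (range_minimalD M 0).symm
    rwa [← minimalComplex_d] at this
  exact_succ i := by
    have : Function.Exact (minimalD M (i + 1)) (minimalD M i) :=
      LinearMap.exact_iff.mpr ((ker_minimalD M i).trans (range_minimalD M (i + 1)).symm)
    rwa [← minimalComplex_d, ← minimalComplex_d] at this

lemma range_minimalComplex_d_le (M : FGMod R) (i : ℕ) :
    LinearMap.range ((minimalComplex M).d (i + 1) i).hom ≤
      maximalIdeal R • (⊤ : Submodule R ((minimalComplex M).X i)) := by
  have h := (range_minimalD M i).trans_le (ker_coverMap_le (syzygy M i))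
  rw [← minimalComplex_d] at h
  exact h

/-- The stable ideal of a finitely generated module of infinite projective dimension is proper. -/
lemma Istab_le_maximalIdeal (L : ModuleCat.{u} R) [Module.Finite R L]
    (h : projectiveDimension L = ⊤) : Istab (moduleComplex L) 1 ≤ maximalIdeal R := by
  let M : FGMod R := ⟨L, ‹_›⟩
  have hres := isResolution_minimalComplex M
  -- A zero term would bring in the convention `I^1 = R` and destroy the bound.
  have hnz (i : ℕ) : ¬ IsZero ((minimalComplex M).X i) := by
    intro hi
    have := hres.hasProjectiveDimensionLT_of_isZero i hi
    have h' : projectiveDimension L < (i + 1 : ℕ) := projectiveDimension_lt_iff.mpr this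
    rw [h] at h'
    exact not_top_lt h'
  refine iInf_le_of_le ((minimalComplex M).extend (embeddingGE 0)) <| iInf₂_le_of_le
    (toModuleComplex _ hres.d_comp)
    (hres.isMinimalFreeResolution hres.d_comp (range_minimalComplex_d_le M)) <|
    iInf₂_le_of_le 0 ⟨0, le_rfl, ?_⟩ ?_
  · rw [isZero_extend_embeddingGE_iff _ 0 0 0 (by simp)]
    exact hnz 0
  · refine (totalIdeal_truncGE_le _ _ _).trans ?_
    rw [totalIdeal_extend]
    refine iSup₂_le fun m _ ↦ minorsIdeal_one_le _ ?_ ?_ (range_minimalComplex_d_le M m)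
    · rw [← ModuleCat.isZero_iff_subsingleton]
      exact hnz _
    · rw [← ModuleCat.isZero_iff_subsingleton]
      exact hnz _

/-- The ideal is squeezed between a power of `𝔪` killing `L` and `𝔪` itself. -/
lemma isMaximalPrimary_Istab (L : ModuleCat.{u} R) (hL : IsFiniteLength R L)
    (h : projectiveDimension L = ⊤) : IsMaximalPrimary (Istab (moduleComplex L) 1) := by
  obtain ⟨n, hn⟩ := exists_maximalIdeal_pow_le_annihilator L hL
  have := (isFiniteLength_iff_isNoetherian_isArtinian.mp hL).1
  have hle := Istab_le_maximalIdeal L h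
  have hrad : (Istab (moduleComplex L) 1).radical = maximalIdeal R := by
    apply le_antisymm
    · exact (Ideal.IsPrime.radical_le_iff inferInstance).mpr hle
    · intro x hx
      exact ⟨n, annihilator_le_Istab L (hn (Ideal.pow_mem_pow hx n))⟩
  refine ⟨Ideal.isPrimary_of_isMaximal_radical ?_, hrad⟩
  rw [hrad]
  infer_instance

lemma Istab_residueField
    (h : projectiveDimension (ModuleCat.of R (ResidueField R)) = ⊤) :
    Istab (moduleComplex (ModuleCat.of R (ResidueField R))) 1 = maximalIdeal R := by
  have : Module.Finite R (ModuleCat.of R (ResidueField R)) :=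
    inferInstanceAs (Module.Finite R (R ⧸ maximalIdeal R))
  refine le_antisymm (Istab_le_maximalIdeal _ h) (le_trans ?_ (annihilator_le_Istab _))
  exact (Ideal.annihilator_quotient (I := maximalIdeal R)).ge

end Existence

/-! ### Finite projective dimension of the residue field forces regularity. -/

section Regular

variable {R : Type u} [CommRing R]

lemma hasProjectiveDimensionLT_ker {P M : Type u} [AddCommGroup P] [Module R P] [AddCommGroup M]
    [Module R M] [Module.Projective R P] (f : P →ₗ[R] M) (hf : Function.Surjective f) (n : ℕ)
    (h : HasProjectiveDimensionLT (ModuleCat.of R M) (n + 2)) :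
    HasProjectiveDimensionLT (ModuleCat.of R (LinearMap.ker f)) (n + 1) := by
  have hP : Projective (ModuleCat.of R P) := (IsProjective.iff_projective P).mp ‹_›
  exact (LinearMap.shortExact_shortComplexKer hf).hasProjectiveDimensionLT_X₁ (n + 1)
    (hasProjectiveDimensionLT_of_ge _ 1 _ (by omega)) h

/-- Reduction modulo `x` as a functor to modules over `R / x`, on morphisms. -/
noncomputable def quotSMulTopMap (x : R) {M N : Type u} [AddCommGroup M] [Module R M]
    [AddCommGroup N] [Module R N] (f : M →ₗ[R] N) :
    ModuleCat.of (R ⧸ Ideal.span {x}) (QuotSMulTop x M) ⟶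
      ModuleCat.of (R ⧸ Ideal.span {x}) (QuotSMulTop x N) :=
  ModuleCat.ofHom ((QuotSMulTop.map x f).extendScalarsOfSurjective Ideal.Quotient.mk_surjective)

lemma quotSMulTopMap_comp {x : R} {K P M : Type u} [AddCommGroup K] [Module R K] [AddCommGroup P]
    [Module R P] [AddCommGroup M] [Module R M] {f : K →ₗ[R] P} {g : P →ₗ[R] M}
    (hexact : Function.Exact f g) (hg : Function.Surjective g) :
    quotSMulTopMap x f ≫ quotSMulTopMap x g = 0 := by
  ext1
  apply LinearMap.ext
  exact (QuotSMulTop.map_exact x hexact hg).apply_apply_eq_zero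

/-- Injectivity on the left is the vanishing of `Tor_1(M, R/x)` for `x` regular on `M`. -/
lemma shortExact_quotSMulTop {x : R} {K P M : Type u} [AddCommGroup K] [Module R K]
    [AddCommGroup P] [Module R P] [AddCommGroup M] [Module R M] {f : K →ₗ[R] P} {g : P →ₗ[R] M}
    (hM : IsSMulRegular M x) (hf : Function.Injective f) (hexact : Function.Exact f g)
    (hg : Function.Surjective g) :
    (ShortComplex.mk _ _ (quotSMulTopMap_comp (x := x) hexact hg)).ShortExact := by
  apply ModuleCat.shortComplex_shortExact
  · exact QuotSMulTop.map_exact x hexact hg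
  · have h0 : Function.Exact (0 : K →ₗ[R] K) f :=
      LinearMap.exact_iff.mpr (by simp [LinearMap.ker_eq_bot.mpr hf])
    have h := QuotSMulTop.map_first_exact_on_four_term_exact_of_isSMulRegular_last h0 hexact hM
    rw [map_zero] at h
    refine (injective_iff_map_eq_zero (QuotSMulTop.map x f)).mpr fun y hy ↦ ?_
    obtain ⟨z, hz⟩ := (h y).mp hy
    exact hz.symm
  · exact QuotSMulTop.map_surjective x hg

/-- Induct along a free cover: its kernel inherits regularity of `x`, and reduction mod `x` keeps
the sequence exact and projectives projective. -/
lemma hasProjectiveDimensionLT_quotSMulTop (x : R) (hx : IsSMulRegular R x) (n : ℕ) (M : Type u)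
    [AddCommGroup M] [Module R M] (hM : IsSMulRegular M x)
    (h : HasProjectiveDimensionLT (ModuleCat.of R M) (n + 1)) :
    HasProjectiveDimensionLT (ModuleCat.of (R ⧸ Ideal.span {x}) (QuotSMulTop x M)) (n + 1) := by
  have proj (P : Type u) [AddCommGroup P] [Module R P] [Module.Projective R P] :
      Projective (ModuleCat.of (R ⧸ Ideal.span {x}) (QuotSMulTop x P)) := by
    rw [← IsProjective.iff_projective]
    exact Module.Projective.of_equiv ((QuotSMulTop.equivQuotTensor x P).extendScalarsOfSurjective
      Ideal.Quotient.mk_surjective).symm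
  induction n generalizing M with
  | zero =>
    have : Projective (ModuleCat.of R M) := inferInstance
    have : Module.Projective R M := (IsProjective.iff_projective M).mpr this
    have := proj M
    exact inferInstanceAs (HasProjectiveDimensionLT
      (ModuleCat.of (R ⧸ Ideal.span {x}) (QuotSMulTop x M)) 1)
  | succ n ih =>
    let f : (M →₀ R) →ₗ[R] M := Finsupp.linearCombination R id
    have hf : Function.Surjective f := Finsupp.linearCombination_id_surjective R M
    have hfree : IsSMulRegular (M →₀ R) x := fun a b hab ↦ by
      ext i
      exact hx (DFunLike.congr_fun hab i)
    have hK : IsSMulRegular (LinearMap.ker f) x := fun a b hab ↦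
      Subtype.ext (hfree (congrArg Subtype.val hab))
    have h₁ := ih (LinearMap.ker f) hK (hasProjectiveDimensionLT_ker f hf n h)
    have hS := shortExact_quotSMulTop (K := LinearMap.ker f) hM
      (LinearMap.ker f).injective_subtype (LinearMap.exact_subtype_ker_map f) hf
    have := proj (M →₀ R)
    exact hS.hasProjectiveDimensionLT_X₃ (n + 1) h₁
      (hasProjectiveDimensionLT_of_ge _ 1 _ (by omega))

variable [IsLocalRing R]

lemma eq_zero_of_smul_maximalIdeal_smul_top {M : Type u} [AddCommGroup M] [Module R M] {a : R}
    (ha : ∀ y ∈ maximalIdeal R, a * y = 0) {v : M}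
    (hv : v ∈ maximalIdeal R • (⊤ : Submodule R M)) : a • v = 0 := by
  induction hv using Submodule.smul_induction_on' with
  | smul r hr n _ => rw [smul_smul, ha r hr, zero_smul]
  | add x _ y _ hx hy => rw [smul_add, hx, hy, add_zero]

lemma nontrivial_quotient_span {x : R} (hx : x ∈ maximalIdeal R) :
    Nontrivial (R ⧸ Ideal.span {x}) :=
  Ideal.Quotient.nontrivial_iff.mpr fun h ↦ (maximalIdeal.isMaximal R).ne_top
    (top_le_iff.mp (h ▸ (Ideal.span_singleton_le_iff_mem _).mpr hx))

variable [IsNoetherianRing R]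

/-- Over a local ring of depth zero, finitely generated modules of finite projective dimension are
free. -/
lemma free_of_hasProjectiveDimensionLT {a : R} (ha0 : a ≠ 0)
    (ha : ∀ y ∈ maximalIdeal R, a * y = 0) (n : ℕ) (M : Type u) [AddCommGroup M] [Module R M]
    [Module.Finite R M] (h : HasProjectiveDimensionLT (ModuleCat.of R M) (n + 1)) :
    Module.Free R M := by
  induction n generalizing M with
  | zero =>
    have : Projective (ModuleCat.of R M) := inferInstance
    have : Module.Projective R M := (IsProjective.iff_projective M).mpr this
    exact Module.free_of_flat_of_isLocalRing
  | succ n ih =>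
    obtain ⟨r, f, hf, hker⟩ := exists_minimal_cover (R := R) M
    have hfree := ih (LinearMap.ker f) (hasProjectiveDimensionLT_ker f hf n h)
    -- The socle element `a` kills `ker f ⊆ 𝔪 R^r`, but a nonzero free module is faithful.
    have hsub : Subsingleton (LinearMap.ker f) := by
      by_contra hns
      rw [not_subsingleton_iff_nontrivial] at hns
      have hmem : a ∈ Module.annihilator R (LinearMap.ker f) := Module.mem_annihilator.mpr
        fun v ↦ Subtype.ext (eq_zero_of_smul_maximalIdeal_smul_top ha (hker v.2))
      rw [Module.annihilator_eq_bot.mpr inferInstance] at hmem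
      exact ha0 hmem
    have hinj : Function.Injective f :=
      LinearMap.ker_eq_bot.mp ((Submodule.subsingleton_iff_eq_bot).mp hsub)
    exact Module.Free.of_equiv (LinearEquiv.ofBijective f ⟨hinj, hf⟩)

lemma maximalIdeal_eq_bot_of_socle {a : R} (ha0 : a ≠ 0)
    (ha : ∀ y ∈ maximalIdeal R, a * y = 0) (n : ℕ)
    (h : HasProjectiveDimensionLT (ModuleCat.of R (ResidueField R)) (n + 1)) :
    maximalIdeal R = ⊥ := by
  have : Module.Finite R (ResidueField R) :=
    inferInstanceAs (Module.Finite R (R ⧸ maximalIdeal R))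
  have hfree := free_of_hasProjectiveDimensionLT ha0 ha n (ResidueField R) h
  have h₁ : Module.annihilator R (ResidueField R) = maximalIdeal R :=
    Ideal.annihilator_quotient (I := maximalIdeal R)
  rw [← h₁]
  exact Module.annihilator_eq_bot.mpr inferInstance

/-- Otherwise `𝔪` is covered by `𝔪²` and the finitely many associated primes. Prime avoidance leaves
`𝔪 ⊆ 𝔪²`, excluded by Nakayama, or `𝔪` inside the annihilator of a nonzero `a`, excluded by the
depth-zero case. -/
lemma exists_isSMulRegular_notMem_sq (hm : maximalIdeal R ≠ ⊥) (n : ℕ)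
    (h : HasProjectiveDimensionLT (ModuleCat.of R (ResidueField R)) (n + 1)) :
    ∃ x ∈ maximalIdeal R, x ∉ maximalIdeal R ^ 2 ∧ IsSMulRegular R x := by
  by_contra! hcon
  have hfin := associatedPrimes.finite R R
  let s : Finset (Ideal R) := insert (maximalIdeal R ^ 2) hfin.toFinset
  have hsub : (maximalIdeal R : Set R) ⊆ ⋃ i ∈ (s : Set (Ideal R)), (i : Set R) := by
    intro x hx
    by_cases hx2 : x ∈ maximalIdeal R ^ 2
    · exact Set.mem_biUnion (x := maximalIdeal R ^ 2) (by simp [s]) hx2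
    · have h₁ : x ∈ ⋃ p ∈ associatedPrimes R R, (p : Set R) := by
        rw [biUnion_associatedPrimes_eq_compl_regular]
        exact hcon x hx hx2
      obtain ⟨p, hp, hxp⟩ := Set.mem_iUnion₂.mp h₁
      exact Set.mem_biUnion (x := p) (by simp [s, hp]) hxp
  -- Prime avoidance tolerates two ideals that are not prime; `𝔪²` fills both places.
  have hprimes : ∀ i ∈ s, i ≠ maximalIdeal R ^ 2 → i ≠ maximalIdeal R ^ 2 → i.IsPrime := by
    intro i hi hne _
    simp only [s, Finset.mem_insert, hne, false_or, Set.Finite.mem_toFinset] at hi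
    exact IsAssociatedPrime.isPrime hi
  obtain ⟨p, hp, hle⟩ := (Ideal.subset_union_prime (f := id) _ _ hprimes).mp hsub
  simp only [s, Finset.mem_insert, Set.Finite.mem_toFinset] at hp
  obtain rfl | hp := hp
  · refine hm (Submodule.eq_bot_of_le_smul_of_le_jacobson_bot (maximalIdeal R) _
      (IsNoetherian.noetherian _) ?_ (maximalIdeal_le_jacobson _))
    rwa [smul_eq_mul, ← pow_two]
  · obtain ⟨hprime, a, ha⟩ := isAssociatedPrime_iff.mp hp
    refine hm (maximalIdeal_eq_bot_of_socle (a := a) ?_ ?_ n h)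
    · rintro rfl
      exact hprime.ne_top (by rw [ha]; simp)
    · intro y hy
      have h₁ : y ∈ p := hle hy
      rw [ha, Submodule.mem_colon_singleton] at h₁
      simpa [mul_comm] using h₁

/-- If `x` does not lie in the square of the maximal ideal, then the residue field is a direct
summand of `𝔪 / x𝔪`. -/
lemma nonempty_retract_residueField {x : R} (hx : x ∈ maximalIdeal R)
    (hx2 : x ∉ maximalIdeal R ^ 2) [IsLocalRing (R ⧸ Ideal.span {x})] :
    Nonempty (Retract (ModuleCat.of (R ⧸ Ideal.span {x}) (ResidueField (R ⧸ Ideal.span {x})))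
      (ModuleCat.of (R ⧸ Ideal.span {x}) (QuotSMulTop x (maximalIdeal R)))) := by
  let R' := R ⧸ Ideal.span {x}
  let m := maximalIdeal R
  have hloc : IsLocalHom (Ideal.Quotient.mk (Ideal.span {x})) :=
    IsLocalHom.of_surjective _ Ideal.Quotient.mk_surjective
  let x' : m := ⟨x, hx⟩
  -- The section sends `1` to the class of `x`; it is well defined because `𝔪 x = x 𝔪` dies in the
  -- target.
  let i : ResidueField R' →ₗ[R'] QuotSMulTop x m :=
    (maximalIdeal R').liftQ (LinearMap.toSpanSingleton R' _ (Submodule.Quotient.mk x')) <| by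
      intro c hc
      obtain ⟨y, rfl⟩ := Ideal.Quotient.mk_surjective c
      have hy : y ∈ maximalIdeal R := by
        rw [mem_maximalIdeal, mem_nonunits_iff] at hc ⊢
        exact fun hu ↦ hc (hu.map _)
      rw [LinearMap.mem_ker, LinearMap.toSpanSingleton_apply]
      change Submodule.Quotient.mk (y • x') = 0
      rw [Submodule.Quotient.mk_eq_zero]
      have : y • x' = x • (⟨y, hy⟩ : m) := Subtype.ext (mul_comm _ _)
      rw [this]
      exact Submodule.smul_mem_pointwise_smul _ _ _ trivial
  have hcot : m.toCotangent x' ≠ 0 := fun h ↦ hx2 ((Ideal.toCotangent_eq_zero m x').mp h)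
  -- As `x ∉ 𝔪²`, some functional on `𝔪/𝔪²` takes the value `1` at `x`; it induces the retraction.
  obtain ⟨φ, hφ⟩ := Module.Projective.exists_dual_eq_one (ResidueField R)
    (V := CotangentSpace R) hcot
  let ρ : ResidueField R →+* ResidueField R' := ResidueField.map (Ideal.Quotient.mk _)
  let ρ' : ResidueField R →ₗ[R] ResidueField R' :=
    { toFun := ρ
      map_add' := map_add ρ
      map_smul' := fun c y ↦ by
        rw [Algebra.smul_def, map_mul, Algebra.smul_def]
        rfl }
  let ψ : m →ₗ[R] ResidueField R' := ρ' ∘ₗ (φ.restrictScalars R) ∘ₗ m.toCotangent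
  let r₀ : QuotSMulTop x m →ₗ[R] ResidueField R' :=
    Submodule.liftQ _ ψ <| by
      intro y hy
      obtain ⟨z, -, rfl⟩ := (Submodule.mem_smul_pointwise_iff_exists _ _ _).mp hy
      rw [LinearMap.mem_ker, map_smul, ← algebraMap_smul R' x (ψ z)]
      have : algebraMap R R' x = 0 := Ideal.Quotient.eq_zero_iff_mem.mpr
        (Ideal.mem_span_singleton_self x)
      rw [this, zero_smul]
  let r : QuotSMulTop x m →ₗ[R'] ResidueField R' :=
    r₀.extendScalarsOfSurjective Ideal.Quotient.mk_surjective
  have hri : r ∘ₗ i = LinearMap.id := by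
    apply Submodule.linearMap_qext
    apply LinearMap.ext_ring
    change r₀ ((1 : R') • Submodule.Quotient.mk x') = 1
    rw [one_smul]
    change ρ (φ (m.toCotangent x')) = 1
    rw [hφ, map_one]
  exact ⟨⟨ModuleCat.ofHom i, ModuleCat.ofHom r, by rw [← ModuleCat.ofHom_comp, hri]; rfl⟩⟩

lemma hasProjectiveDimensionLT_residueField_quotient {x : R} (hx : x ∈ maximalIdeal R)
    (hx2 : x ∉ maximalIdeal R ^ 2) (hreg : IsSMulRegular R x) [IsLocalRing (R ⧸ Ideal.span {x})]
    (n : ℕ) (h : HasProjectiveDimensionLT (ModuleCat.of R (ResidueField R)) (n + 1)) :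
    HasProjectiveDimensionLT (ModuleCat.of (R ⧸ Ideal.span {x})
      (ResidueField (R ⧸ Ideal.span {x}))) (n + 1) := by
  -- Weakening the bound to `n + 2` first gives `𝔪` the bound `n + 1`. It need not drop, since the
  -- main induction is on dimension.
  have h₁ := hasProjectiveDimensionLT_ker (Algebra.linearMap R (ResidueField R)) residue_surjective
    n (hasProjectiveDimensionLT_of_ge _ (n + 1) (n + 2) (by omega))
  have hker : LinearMap.ker (Algebra.linearMap R (ResidueField R)) = maximalIdeal R := ker_residue
  rw [hker] at h₁
  have hm : IsSMulRegular (maximalIdeal R) x := fun a b hab ↦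
    Subtype.ext (hreg (congrArg Subtype.val hab))
  have := hasProjectiveDimensionLT_quotSMulTop x hreg n _ hm h₁
  obtain ⟨e⟩ := nonempty_retract_residueField hx hx2
  exact e.hasProjectiveDimensionLT _

/-- Lifts of generators of the maximal ideal of `R/x`, together with `x`, generate `𝔪`. -/
lemma spanFinrank_maximalIdeal_le_quotient_add_one {x : R}
    [IsLocalRing (R ⧸ Ideal.span {x})] : (maximalIdeal R).spanFinrank ≤
      (maximalIdeal (R ⧸ Ideal.span {x})).spanFinrank + 1 := by
  let q := Ideal.Quotient.mk (Ideal.span {x})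
  have hloc : IsLocalHom q := IsLocalHom.of_surjective _ Ideal.Quotient.mk_surjective
  have hcomap : (maximalIdeal (R ⧸ Ideal.span {x})).comap q = maximalIdeal R :=
    maximalIdeal_comap q
  have hfg := (maximalIdeal (R ⧸ Ideal.span {x})).fg_of_isNoetherianRing
  let G := (maximalIdeal (R ⧸ Ideal.span {x})).generators
  have hG : G.Finite := Submodule.FG.finite_generators hfg
  let g := Function.surjInv (f := q) Ideal.Quotient.mk_surjective
  have hspan : Ideal.span (insert x (g '' G)) = maximalIdeal R := by
    have h₁ : (Ideal.span (g '' G)).map q = maximalIdeal (R ⧸ Ideal.span {x}) := by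
      rw [Ideal.map_span, ← Set.image_comp,
        (Function.rightInverse_surjInv (f := q) Ideal.Quotient.mk_surjective).comp_eq_id,
        Set.image_id]
      exact Submodule.span_generators _
    rw [← hcomap, ← h₁, Ideal.comap_map_of_surjective' _ Ideal.Quotient.mk_surjective,
      Ideal.mk_ker, Ideal.span_insert, sup_comm]
  rw [← hspan]
  refine (Submodule.spanFinrank_span_le_ncard_of_finite ((hG.image g).insert x)).trans ?_
  refine (Set.ncard_insert_le _ _).trans (Nat.add_le_add_right ?_ 1)
  exact (Set.ncard_image_le hG).trans (Submodule.FG.generators_ncard hfg).le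

variable (R) in
lemma exists_ringKrullDim_eq_natCast : ∃ d : ℕ, ringKrullDim R = d := by
  have h : (maximalIdeal R).height ≠ ⊤ :=
    Ideal.height_ne_top (maximalIdeal.isMaximal R).ne_top
  obtain ⟨d, hd⟩ := ENat.ne_top_iff_exists.mp h
  exact ⟨d, by rw [← maximalIdeal_height_eq_ringKrullDim, ← hd]; rfl⟩

end Regular

/-- A Noetherian local ring whose residue field has finite projective dimension is regular. -/
theorem isRegularLocalRing_of_hasProjectiveDimensionLT (R : Type u) [CommRing R]
    [IsLocalRing R] [IsNoetherianRing R] (n : ℕ)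
    (h : HasProjectiveDimensionLT (ModuleCat.of R (ResidueField R)) (n + 1)) :
    IsRegularLocalRing R := by
  obtain ⟨d, hd⟩ := exists_ringKrullDim_eq_natCast R
  induction d using Nat.strong_induction_on generalizing R with
  | _ d ih =>
  apply IsRegularLocalRing.of_spanFinrank_maximalIdeal_le
  by_cases hm : maximalIdeal R = ⊥
  · rw [hm, Submodule.spanFinrank_bot]
    exact ringKrullDim_nonneg_of_nontrivial
  · obtain ⟨x, hx, hx2, hreg⟩ := exists_isSMulRegular_notMem_sq hm n h
    have := nontrivial_quotient_span hx
    have : IsLocalRing (R ⧸ Ideal.span {x}) :=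
      IsLocalRing.of_surjective' _ Ideal.Quotient.mk_surjective
    have h₁ := ringKrullDim_quotient_span_singleton_succ_eq_ringKrullDim hreg hx
    obtain ⟨d', hd'⟩ := exists_ringKrullDim_eq_natCast (R ⧸ Ideal.span {x})
    have h₂ : d' + 1 = d := by
      rw [hd, hd'] at h₁
      exact_mod_cast h₁
    have h₃ := ih d' (by omega) _
      (hasProjectiveDimensionLT_residueField_quotient hx hx2 hreg n h) hd'
    -- The dimension drops by exactly one and the number of generators by at most one, so equality
    -- for `R/x` gives the inequality for `R`.
    rw [← h₁, ← h₃.spanFinrank_maximalIdeal]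
    exact_mod_cast spanFinrank_maximalIdeal_le_quotient_add_one

lemma projectiveDimension_residueField_eq_top {R : Type u} [CommRing R] [IsLocalRing R]
    [IsNoetherianRing R] (h : ¬ IsRegularLocalRing R) :
    projectiveDimension (ModuleCat.of R (ResidueField R)) = ⊤ := by
  by_contra hne
  obtain ⟨n, hn⟩ := (projectiveDimension_ne_top_iff _).mp hne
  exact h (isRegularLocalRing_of_hasProjectiveDimensionLT R n hn)

end StableMinors

theorem mainTheorem11 (R : Type u) [CommRing R] [IsLocalRing R] [IsNoetherianRing R] :
    ((∀ M : ChainComplex (ModuleCat.{u} R) ℤ, StableMinors.IsCPlusF M →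
        StableMinors.ca R ≤ StableMinors.Istab M 1) ∧
      StableMinors.ca R ≤ StableMinors.IstabCPlusF R 1 ∧
      StableMinors.IstabCPlusF R 1 = StableMinors.IstabMod R 1 ∧
      (StableMinors.ca R ≠ ⊥ → StableMinors.IstabCPlusF R 1 ≠ ⊥)) ∧
    (¬ IsRegularLocalRing R →
      StableMinors.Istab
        (StableMinors.moduleComplex (ModuleCat.of R (ResidueField R))) 1 = maximalIdeal R ∧
      ∀ L : ModuleCat.{u} R, IsFiniteLength R L →
        (projectiveDimension L = ⊤ →
          StableMinors.IsMaximalPrimary (StableMinors.Istab (StableMinors.moduleComplex L) 1)) ∧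
        (projectiveDimension L ≠ ⊤ →
          StableMinors.Istab (StableMinors.moduleComplex L) 1 = ⊤)) := by
  refine ⟨⟨fun M hM ↦ StableMinors.ca_le_Istab hM, StableMinors.ca_le_IstabCPlusF,
    StableMinors.IstabCPlusF_eq_IstabMod, fun h h' ↦ h ?_⟩, fun hreg ↦
    ⟨StableMinors.Istab_residueField (StableMinors.projectiveDimension_residueField_eq_top hreg),
      fun L hL ↦ ⟨StableMinors.isMaximalPrimary_Istab L hL,
        StableMinors.Istab_eq_top_of_projectiveDimension_ne_top L⟩⟩⟩
  exact le_bot_iff.mp (h' ▸ StableMinors.ca_le_IstabCPlusF)
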